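/- Let $n\ge 2$, $p\ge 1$, and let $\mathbf x_1,\dots,\mathbf x_n$ be i.i.d. random vectors in $\mathbb R^p$ from an elliptical distribution with mean vector $\boldsymbol\mu$ and positive definite covariance matrix $\mathbf M$, that is, with probability density $$f(\mathbf x)=C\,|\mathbf M|^{-1/2}\,g\big((\mathbf x-\boldsymbol\mu)^\top\mathbf M^{-1}(\mathbf x-\boldsymbol\mu)\big),$$ where $g:[0,\infty)\to[0,\infty)$ is a density generator, scaled so that $\mathbf M$ is the covariance matrix of the distribution, and $C>0$ is a normalizing constant. Assume that the distribution has finite fourth-order moments. Let $$\kappa=\frac{\mathrm E[r^4]}{p(p+2)}-1,\qquad r^2=(\mathbf x_1-\boldsymbol\mu)^\top\mathbf M^{-1}(\mathbf x_1-\boldsymbol\mu),$$ be its elliptical kurtosis parameter, and let $$\mathbf S=\frac1{n-1}\sum_{i=1}^n(\mathbf x_i-\bar{\mathbf x})(\mathbf x_i-\bar{\mathbf x})^\top,\qquad \bar{\mathbf x}=\frac1n\sum_{i=1}^n\mathbf x_i,$$ be the sample covariance matrix. Then $\mathrm{tr}(\mathbf S^2)$ and $\mathrm{tr}(\mathbf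 S)^2$ are integrable, $$\mathrm E[\mathrm{tr}(\mathbf S^2)]=\Big(\frac1{n-1}+\frac{\kappa}{n}\Big)\mathrm{tr}(\mathbf M)^2+\Big(1+\frac1{n-1}+\frac{2\kappa}{n}\Big)\mathrm{tr}(\mathbf M^2),$$ and $$\mathrm E[\mathrm{tr}(\mathbf S)^2]=\Big(1+\frac{\kappa}{n}\Big)\mathrm{tr}(\mathbf M)^2+2\Big(\frac1{n-1}+\frac{\kappa}{n}\Big)\mathrm{tr}(\mathbf M^2).$$ -/

import Mathlib

open MeasureTheory ProbabilityTheory Matrix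

noncomputable section

/-- The generating variate `r = √((x - μ)ᵀ M⁻¹ (x - μ))`, as a function of the observation `x`. -/
def generatingVariate {p : ℕ} (μ : Fin p → ℝ) (M : Matrix (Fin p) (Fin p) ℝ)
    (x : Fin p → ℝ) : ℝ :=
  Real.sqrt ((x - μ) ⬝ᵥ (M⁻¹ *ᵥ (x - μ)))

/-- The elliptical density `C |M|^{-1/2} g((x - μ)ᵀ M⁻¹ (x - μ))`. -/
def ellipticalDensity {p : ℕ} (C : ℝ) (μ : Fin p → ℝ) (M : Matrix (Fin p) (Fin p) ℝ)
    (g : ℝ → ℝ) (x : Fin p → ℝ) : ℝ :=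
  C * (Real.sqrt M.det)⁻¹ * g ((x - μ) ⬝ᵥ (M⁻¹ *ᵥ (x - μ)))

/-- `F` is the elliptical distribution on `ℝᵖ` with mean vector `μ`, positive definite covariance
matrix `M` and density generator `g : [0, ∞) → [0, ∞)` (values of `g` at negative arguments play
no role). The generator is scaled so that `M` is the covariance matrix of `F`. -/
structure IsElliptical {p : ℕ} (F : Measure (Fin p → ℝ)) (μ : Fin p → ℝ)
    (M : Matrix (Fin p) (Fin p) ℝ) (g : ℝ → ℝ) : Prop where
  isProbabilityMeasure : IsProbabilityMeasure F
  posDef : M.PosDef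
  measurable_generator : Measurable g
  generator_nonneg : ∀ t : ℝ, 0 ≤ t → 0 ≤ g t
  /-- `F` has the elliptical density, for some normalizing constant `C`. -/
  density : ∃ C : ℝ, 0 < C ∧
    F = volume.withDensity (fun x => ENNReal.ofReal (ellipticalDensity C μ M g x))
  /-- The second moments are finite, so that mean and covariance exist. -/
  memLp_two : ∀ i, MemLp (fun x : Fin p → ℝ => x i) 2 F
  mean : ∀ i, ∫ x, x i ∂F = μ i
  covariance : ∀ i j, ∫ x, (x i - μ i) * (x j - μ j) ∂F = M i j

/-- The elliptical kurtosis parameter `κ = E[r⁴] / (p (p + 2)) - 1`. -/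
def ellipticalKurtosis {p : ℕ} (F : Measure (Fin p → ℝ)) (μ : Fin p → ℝ)
    (M : Matrix (Fin p) (Fin p) ℝ) : ℝ :=
  (∫ x, generatingVariate μ M x ^ 4 ∂F) / ((p : ℝ) * ((p : ℝ) + 2)) - 1

/-- The sample mean vector of `x₁, …, xₙ`. -/
def sampleMean {n p : ℕ} (x : Fin n → Fin p → ℝ) : Fin p → ℝ :=
  (n : ℝ)⁻¹ • ∑ i, x i

/-- The sample covariance matrix `(n - 1)⁻¹ ∑ᵢ (xᵢ - x̄) (xᵢ - x̄)ᵀ`. -/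
def sampleCov {n p : ℕ} (x : Fin n → Fin p → ℝ) : Matrix (Fin p) (Fin p) ℝ :=
  ((n : ℝ) - 1)⁻¹ • ∑ i, vecMulVec (x i - sampleMean x) (x i - sampleMean x)

end

/-! Each entry of S is a bilinear form in the centred observations with weight W = (n - 1)⁻¹ (I -
J/n), J being the all-ones matrix. In the mean of a product of two entries, independence leaves only
the three pairings of the sample indices, plus a fourth cumulant of one observation when all indices
agree. Their coefficients are (tr W)² = 1, tr(W Wᵀ) = tr(W²) = 1/(n - 1) and ∑ W_kk² = 1/n
(`integral_bilinear_mul_bilinear_of_iid`).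

Ellipticity enters only through the cumulant. Reflections preserving the form of M⁻¹ preserve F, so
E[(a ⬝ (x - μ))⁴] depends only on aᵀMa and equals c (aᵀMa)². Polarization yields the mixed moments,
and computing E[r⁴] gives c/3 = 1 + κ (`integral_coord_sq_mul_sq`). The cumulants needed are then κ
(M_ii M_jj + 2 M_ij²); summing over i, j gives both formulas. -/

instance ENNReal.holderTriple_four_four_two : ENNReal.HolderTriple 4 4 2 where
  inv_add_inv_eq_inv := by
    have h : (4 : ENNReal)⁻¹ = 2⁻¹ * 2⁻¹ := by
      rw [← ENNReal.mul_inv (by simp) (by simp)]; norm_num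
    rw [h, ← mul_add, ENNReal.inv_two_add_inv_two, mul_one]

section Moments

variable {α : Type*} [MeasurableSpace α] {ν : Measure α}

theorem MeasureTheory.MemLp.integrable_mul_four {f g h e : α → ℝ}
    (hf : MemLp f 4 ν) (hg : MemLp g 4 ν) (hh : MemLp h 4 ν) (he : MemLp e 4 ν) :
    Integrable (fun x => f x * g x * h x * e x) ν := by
  have h₁ : MemLp (f * g) 2 ν := hg.mul hf
  have h₂ : MemLp (h * e) 2 ν := he.mul hh
  refine (h₁.integrable_mul h₂).congr (.of_forall fun x => ?_)
  simp [mul_assoc]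

end Moments

/-! ### Fourth moments of i.i.d. samples -/

section Independence

variable {ι Ω E : Type*} [Fintype ι] [DecidableEq ι] [MeasurableSpace Ω] [MeasurableSpace E]
  {P : Measure Ω} {F : Measure E} {X : ι → Ω → E}

/-- `X k` is independent of the tuple of all other observations, so the centred factor splits off,
whether or not `l`, `m`, `q` coincide. -/
theorem integral_mul_four_eq_zero_of_ne (hlaw : ∀ i, HasLaw (X i) F P) (hindep : iIndepFun X P)
    {f g h e : E → ℝ} (hf : Measurable f) (hg : Measurable g) (hh : Measurable h)
    (he : Measurable e) (hf0 : ∫ x, f x ∂F = 0) {k l m q : ι} (hl : k ≠ l) (hm : k ≠ m)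
    (hq : k ≠ q) :
    ∫ ω, f (X k ω) * (g (X l ω) * h (X m ω) * e (X q ω)) ∂P = 0 := by
  have hind := hindep.indepFun_finset₀ {k} {k}ᶜ disjoint_compl_right
    fun i => (hlaw i).aemeasurable
  let i₀ : ({k} : Finset ι) := ⟨k, by simp⟩
  let l₀ : (({k}ᶜ : Finset ι)) := ⟨l, by simpa using hl.symm⟩
  let m₀ : (({k}ᶜ : Finset ι)) := ⟨m, by simpa using hm.symm⟩
  let q₀ : (({k}ᶜ : Finset ι)) := ⟨q, by simpa using hq.symm⟩
  have hind' := hind.comp (φ := fun y => f (y i₀))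
    (ψ := fun y => g (y l₀) * h (y m₀) * e (y q₀)) (by fun_prop) (by fun_prop)
  have hX := fun i => (hlaw i).aemeasurable
  have key := hind'.integral_fun_mul_eq_mul_integral
    (hf.comp_aemeasurable (hX k)).aestronglyMeasurable
    (((hg.comp_aemeasurable (hX l)).mul (hh.comp_aemeasurable (hX m))).mul
      (he.comp_aemeasurable (hX q))).aestronglyMeasurable
  have h0 : ∫ ω, f (X k ω) ∂P = 0 := by
    rw [← hf0, ← (hlaw k).integral_comp hf.aestronglyMeasurable]; rfl
  refine key.trans ?_
  rw [show (∫ ω, ((fun y => f (y i₀)) ∘ fun a (i : ({k} : Finset ι)) => X i a) ω ∂P) = 0 from h0,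
    zero_mul]

omit [Fintype ι] [DecidableEq ι] in
theorem integral_mul_comp_of_ne (hlaw : ∀ i, HasLaw (X i) F P) (hindep : iIndepFun X P)
    {f g : E → ℝ} (hf : Measurable f) (hg : Measurable g) {k m : ι} (hkm : k ≠ m) :
    ∫ ω, f (X k ω) * g (X m ω) ∂P = (∫ x, f x ∂F) * ∫ x, g x ∂F := by
  have hX := fun i => (hlaw i).aemeasurable
  rw [← (hlaw k).integral_comp hf.aestronglyMeasurable,
    ← (hlaw m).integral_comp hg.aestronglyMeasurable]
  exact ((hindep.indepFun hkm).comp hf hg).integral_fun_mul_eq_mul_integral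
    (hf.comp_aemeasurable (hX k)).aestronglyMeasurable
    (hg.comp_aemeasurable (hX m)).aestronglyMeasurable

/-- The mixed fourth moment of centred functions of an i.i.d. sample. -/
theorem integral_mul_four_of_iid (hlaw : ∀ i, HasLaw (X i) F P) (hindep : iIndepFun X P)
    {f g h e : E → ℝ} (hf : Measurable f) (hg : Measurable g) (hh : Measurable h)
    (he : Measurable e) (hf0 : ∫ x, f x ∂F = 0) (hg0 : ∫ x, g x ∂F = 0)
    (hh0 : ∫ x, h x ∂F = 0) (he0 : ∫ x, e x ∂F = 0) (k l m q : ι) :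
    ∫ ω, f (X k ω) * g (X l ω) * h (X m ω) * e (X q ω) ∂P
      = (if k = l ∧ m = q then (∫ x, f x * g x ∂F) * ∫ x, h x * e x ∂F else 0)
        + (if k = m ∧ l = q then (∫ x, f x * h x ∂F) * ∫ x, g x * e x ∂F else 0)
        + (if k = q ∧ l = m then (∫ x, f x * e x ∂F) * ∫ x, g x * h x ∂F else 0)
        + (if k = l ∧ k = m ∧ k = q then ∫ x, f x * g x * h x * e x ∂F
            - (∫ x, f x * g x ∂F) * (∫ x, h x * e x ∂F)
            - (∫ x, f x * h x ∂F) * (∫ x, g x * e x ∂F)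
            - (∫ x, f x * e x ∂F) * (∫ x, g x * h x ∂F) else 0) := by
  have zero := @integral_mul_four_eq_zero_of_ne ι Ω E _ _ _ _ P F X hlaw hindep
  have pair := @integral_mul_comp_of_ne ι Ω E _ _ P F X hlaw hindep
  -- Either some index is isolated and the integral vanishes, or the indices split into two pairs,
  -- or all agree. In the last case all three pairing terms are present, and the final summand
  -- corrects their sum to the true fourth moment.
  by_cases hkl : k = l
  · subst hkl
    by_cases hkm : k = m
    · subst hkm
      by_cases hkq : k = q
      · subst hkq
        have := (hlaw k).integral_comp
          (f := fun x => f x * g x * h x * e x) (by fun_prop)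
        simp only [and_self, if_true]
        rw [← this]
        simp
      · have := zero he hf hg hh he0 (Ne.symm hkq) (Ne.symm hkq) (Ne.symm hkq)
        simp only [hkq, and_false, false_and, if_false, add_zero]
        rw [← this]
        congr 1; ext ω; ring
    · by_cases hmq : m = q
      · subst hmq
        have := pair (hf.mul hg) (hh.mul he) hkm
        simp only [hkm, and_false, if_false, add_zero, and_self, if_true]
        simp only [Pi.mul_apply] at this
        rw [← this]
        congr 1; ext ω; ring
      · have := zero hh hf hg he hh0 (Ne.symm hkm) (Ne.symm hkm) hmq
        simp only [hkm, hmq, and_false, false_and, if_false, add_zero]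
        rw [← this]
        congr 1; ext ω; ring
  · simp only [hkl, false_and, if_false, zero_add, add_zero]
    by_cases hkm : k = m
    · subst hkm
      have hlk : l ≠ k := Ne.symm hkl
      by_cases hlq : l = q
      · subst hlq
        have := pair (hf.mul hh) (hg.mul he) hkl
        simp only [hkl, hlk, if_false, add_zero, and_self, if_true]
        simp only [Pi.mul_apply] at this
        rw [← this]
        congr 1; ext ω; ring
      · have := zero hg hf hh he hg0 hlk hlk hlq
        simp only [hlq, hlk, and_false, if_false, add_zero]
        rw [← this]
        congr 1; ext ω; ring
    · simp only [hkm, false_and, if_false, zero_add]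
      by_cases hkq : k = q
      · subst hkq
        have hlk : l ≠ k := Ne.symm hkl
        by_cases hlm : l = m
        · subst hlm
          have := pair (hf.mul he) (hg.mul hh) hkl
          simp only [and_self, if_true]
          simp only [Pi.mul_apply] at this
          rw [← this]
          congr 1; ext ω; ring
        · have := zero hg hf hh he hg0 hlk hlm hlk
          simp only [hlm, and_false, if_false]
          rw [← this]
          congr 1; ext ω; ring
      · have := zero hf hg hh he hf0 hkl hkm hkq
        simp only [hkq, false_and, if_false]
        rw [← this]
        congr 1; ext ω; ring

/-- The mixed second moment of two bilinear forms in centred functions of an i.i.d. sample. -/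
theorem integral_bilinear_mul_bilinear_of_iid (hlaw : ∀ i, HasLaw (X i) F P)
    (hindep : iIndepFun X P) (c : Matrix ι ι ℝ)
    {f g h e : E → ℝ} (hf : Measurable f) (hg : Measurable g) (hh : Measurable h)
    (he : Measurable e) (hf4 : MemLp f 4 F) (hg4 : MemLp g 4 F) (hh4 : MemLp h 4 F)
    (he4 : MemLp e 4 F) (hf0 : ∫ x, f x ∂F = 0) (hg0 : ∫ x, g x ∂F = 0)
    (hh0 : ∫ x, h x ∂F = 0) (he0 : ∫ x, e x ∂F = 0) :
    Integrable (fun ω => (∑ k, ∑ l, c k l * (f (X k ω) * g (X l ω)))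
        * ∑ m, ∑ q, c m q * (h (X m ω) * e (X q ω))) P ∧
    ∫ ω, (∑ k, ∑ l, c k l * (f (X k ω) * g (X l ω)))
        * (∑ m, ∑ q, c m q * (h (X m ω) * e (X q ω))) ∂P
      = c.trace ^ 2 * ((∫ x, f x * g x ∂F) * ∫ x, h x * e x ∂F)
        + (c * cᵀ).trace * ((∫ x, f x * h x ∂F) * ∫ x, g x * e x ∂F)
        + (c * c).trace * ((∫ x, f x * e x ∂F) * ∫ x, g x * h x ∂F)
        + (∑ k, c k k ^ 2) * (∫ x, f x * g x * h x * e x ∂F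
            - (∫ x, f x * g x ∂F) * (∫ x, h x * e x ∂F)
            - (∫ x, f x * h x ∂F) * (∫ x, g x * e x ∂F)
            - (∫ x, f x * e x ∂F) * (∫ x, g x * h x ∂F)) := by
  have comp4 : ∀ {u : E → ℝ} (_ : Measurable u) (_ : MemLp u 4 F) (i : ι),
      MemLp (fun ω => u (X i ω)) 4 P := by
    intro u hu hu4 i
    rw [← (hlaw i).map_eq] at hu4
    exact hu4.comp_of_map (hlaw i).aemeasurable
  have hexp : (fun ω => (∑ k, ∑ l, c k l * (f (X k ω) * g (X l ω)))
        * ∑ m, ∑ q, c m q * (h (X m ω) * e (X q ω)))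
      = fun ω => ∑ k, ∑ l, ∑ m, ∑ q, c k l * c m q *
          (f (X k ω) * g (X l ω) * h (X m ω) * e (X q ω)) := by
    ext ω
    simp only [Finset.sum_mul]
    simp only [Finset.mul_sum]
    refine Finset.sum_congr rfl fun k _ => Finset.sum_congr rfl fun l _ =>
      Finset.sum_congr rfl fun m _ => Finset.sum_congr rfl fun q _ => ?_
    ring
  have hint : ∀ k l m q, Integrable (fun ω => c k l * c m q *
      (f (X k ω) * g (X l ω) * h (X m ω) * e (X q ω))) P := fun k l m q =>
    ((comp4 hf hf4 k).integrable_mul_four (comp4 hg hg4 l) (comp4 hh hh4 m)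
      (comp4 he he4 q)).const_mul _
  rw [hexp]
  refine ⟨integrable_finsetSum _ fun k _ => integrable_finsetSum _ fun l _ =>
    integrable_finsetSum _ fun m _ => integrable_finsetSum _ fun q _ => hint k l m q, ?_⟩
  rw [integral_finsetSum _ fun k _ => integrable_finsetSum _ fun l _ =>
    integrable_finsetSum _ fun m _ => integrable_finsetSum _ fun q _ => hint k l m q]
  have hsum : ∀ k, ∫ ω, (∑ l, ∑ m, ∑ q, c k l * c m q *
      (f (X k ω) * g (X l ω) * h (X m ω) * e (X q ω))) ∂P = ∑ l, ∑ m, ∑ q, c k l * c m q *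
      ∫ ω, f (X k ω) * g (X l ω) * h (X m ω) * e (X q ω) ∂P := by
    intro k
    rw [integral_finsetSum _ fun l _ =>
      integrable_finsetSum _ fun m _ => integrable_finsetSum _ fun q _ => hint k l m q]
    refine Finset.sum_congr rfl fun l _ => ?_
    rw [integral_finsetSum _ fun m _ => integrable_finsetSum _ fun q _ => hint k l m q]
    refine Finset.sum_congr rfl fun m _ => ?_
    rw [integral_finsetSum _ fun q _ => hint k l m q]
    refine Finset.sum_congr rfl fun q _ => ?_
    rw [integral_const_mul]
  simp only [hsum, integral_mul_four_of_iid hlaw hindep hf hg hh he hf0 hg0 hh0 he0, mul_add,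
    Finset.sum_add_distrib]
  -- The index constraints collapse the fourfold sum of `c k l * c m q` to one trace expression per
  -- pairing, and to the diagonal when all indices agree.
  congr 1
  · congr 1
    · congr 1
      · simp only [ite_and, mul_ite, mul_zero, Finset.sum_ite_irrel, Finset.sum_ite_eq,
          Finset.mem_univ, if_true, Finset.sum_const_zero]
        simp only [← Finset.sum_mul, ← Finset.mul_sum, Matrix.trace, Matrix.diag, pow_two]
      · simp only [ite_and, mul_ite, mul_zero, Finset.sum_ite_irrel, Finset.sum_ite_eq,
          Finset.mem_univ, if_true, Finset.sum_const_zero]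
        simp only [← Finset.sum_mul, Matrix.trace, Matrix.diag, Matrix.mul_apply,
          Matrix.transpose_apply]
    · simp only [ite_and, mul_ite, mul_zero, Finset.sum_ite_eq,
        Finset.mem_univ, if_true]
      simp only [← Finset.sum_mul, Matrix.trace, Matrix.diag, Matrix.mul_apply]
  · simp only [ite_and, mul_ite, mul_zero, Finset.sum_ite_irrel, Finset.sum_ite_eq,
      Finset.mem_univ, if_true, Finset.sum_const_zero]
    simp only [← Finset.sum_mul, pow_two]

end Independence

/-! ### Reflections for the quadratic form of M⁻¹ -/

section Reflection

variable {ι : Type*} [Fintype ι] [DecidableEq ι]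

/-- The matrix of the reflection `z ↦ z - (2 (w ⬝ z) / (wᵀ M w)) M w`, which is orthogonal for the
quadratic form of `M⁻¹`. -/
noncomputable def formReflection (M : Matrix ι ι ℝ) (w : ι → ℝ) : Matrix ι ι ℝ :=
  1 - (2 / (w ⬝ᵥ (M *ᵥ w))) • vecMulVec (M *ᵥ w) w

theorem formReflection_mulVec (M : Matrix ι ι ℝ) (w z : ι → ℝ) :
    formReflection M w *ᵥ z = z - (2 / (w ⬝ᵥ (M *ᵥ w)) * (w ⬝ᵥ z)) • (M *ᵥ w) := by
  rw [formReflection, sub_mulVec, one_mulVec, smul_mulVec, vecMulVec_mulVec]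
  simp [smul_smul]

theorem formReflection_mul_self {M : Matrix ι ι ℝ} {w : ι → ℝ} (hw : w ⬝ᵥ (M *ᵥ w) ≠ 0) :
    formReflection M w * formReflection M w = 1 := by
  refine Matrix.ext_of_mulVec_single fun i => ?_
  rw [← mulVec_mulVec, one_mulVec, formReflection_mulVec M w (_ *ᵥ _), formReflection_mulVec]
  set z : ι → ℝ := Pi.single i 1
  ext j
  simp only [dotProduct_sub, dotProduct_smul, Pi.sub_apply, Pi.smul_apply, smul_eq_mul]
  field_simp
  ring

theorem abs_det_formReflection {M : Matrix ι ι ℝ} {w : ι → ℝ} (hw : w ⬝ᵥ (M *ᵥ w) ≠ 0) :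
    |(formReflection M w).det| = 1 := by
  have h : (formReflection M w).det * (formReflection M w).det = 1 := by
    rw [← det_mul, formReflection_mul_self hw, det_one]
  rcases mul_self_eq_one_iff.1 h with h | h <;> simp [h]

theorem dotProduct_inv_mulVec_formReflection {M : Matrix ι ι ℝ} (hM : M.PosDef) {w : ι → ℝ}
    (hw : w ⬝ᵥ (M *ᵥ w) ≠ 0) (z : ι → ℝ) :
    (formReflection M w *ᵥ z) ⬝ᵥ (M⁻¹ *ᵥ (formReflection M w *ᵥ z)) = z ⬝ᵥ (M⁻¹ *ᵥ z) := by
  have hinv : M⁻¹ *ᵥ (M *ᵥ w) = w := by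
    rw [mulVec_mulVec, nonsing_inv_mul _ ((isUnit_iff_isUnit_det _).1 hM.isUnit), one_mulVec]
  have hsymm : (M *ᵥ w) ⬝ᵥ (M⁻¹ *ᵥ z) = w ⬝ᵥ z := by
    have ht : (M⁻¹)ᵀ = M⁻¹ := by simpa using hM.inv.isHermitian.eq
    rw [dotProduct_mulVec, ← mulVec_transpose, ht, hinv]
  rw [formReflection_mulVec, mulVec_sub, mulVec_smul, hinv]
  simp only [dotProduct_sub, sub_dotProduct, dotProduct_smul, smul_dotProduct, smul_eq_mul, hsymm]
  rw [dotProduct_comm z w, dotProduct_comm (M *ᵥ w) w]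
  field_simp
  ring

open scoped MatrixOrder Matrix.Norms.L2Operator in
/-- A family that is orthonormal for `M` and diagonalizes the quadratic form of `M⁻¹`. -/
theorem Matrix.PosDef.exists_dual_orthonormal {M : Matrix ι ι ℝ} (hM : M.PosDef) :
    ∃ b : ι → ι → ℝ, (∀ i j, b i ⬝ᵥ (M *ᵥ b j) = if i = j then 1 else 0) ∧
      ∀ z, z ⬝ᵥ (M⁻¹ *ᵥ z) = ∑ i, (b i ⬝ᵥ z) ^ 2 := by
  obtain ⟨B, hB⟩ := CStarAlgebra.nonneg_iff_eq_star_mul_self.1 hM.inv.posSemidef.nonneg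
  rw [star_eq_conjTranspose, conjTranspose_eq_transpose_of_trivial] at hB
  have hMu : IsUnit M.det := (isUnit_iff_isUnit_det _).1 hM.isUnit
  -- With M⁻¹ = BᵀB the rows of `B` are the required family; their orthonormality comes from
  -- commuting the factors of a product equal to 1.
  have hBM : B * M * Bᵀ = 1 := by
    have h1 : Bᵀ * (B * M) = 1 := by rw [← Matrix.mul_assoc, ← hB, nonsing_inv_mul _ hMu]
    exact mul_eq_one_comm.1 h1
  refine ⟨fun i => B i, fun i j => ?_, fun z => ?_⟩
  · rw [← Matrix.one_apply, ← hBM, Matrix.mul_assoc, Matrix.mul_apply']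
    rfl
  · rw [hB, ← mulVec_mulVec, dotProduct_mulVec, vecMul_transpose]
    simp only [dotProduct, mulVec, pow_two]

end Reflection

theorem MeasureTheory.MeasurePreserving.withDensity_of_comp_eq {α : Type*} [MeasurableSpace α]
    {ν : Measure α} {φ : α → α} (hφ : MeasurePreserving φ ν ν) {d : α → ENNReal}
    (hd : Measurable d) (hinv : ∀ x, d (φ x) = d x) :
    MeasurePreserving φ (ν.withDensity d) (ν.withDensity d) := by
  refine ⟨hφ.measurable, Measure.ext fun s hs => ?_⟩
  rw [Measure.map_apply hφ.measurable hs, withDensity_apply _ (hφ.measurable hs),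
    withDensity_apply _ hs, ← hφ.setLIntegral_comp_preimage hs hd]
  simp only [hinv]

theorem measurePreserving_affine_of_abs_det_eq_one {ι : Type*} [Fintype ι] [DecidableEq ι]
    {R : Matrix ι ι ℝ} (hR : |R.det| = 1) (μ : ι → ℝ) :
    MeasurePreserving (fun x : ι → ℝ => R *ᵥ (x - μ) + μ) volume volume := by
  have hdet : R.det ≠ 0 := fun h => by simp [h] at hR
  have hlin : MeasurePreserving (fun x : ι → ℝ => R *ᵥ x) volume volume := by
    refine ⟨(toLin' R).continuous_of_finiteDimensional.measurable, ?_⟩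
    have := Real.map_matrix_volume_pi_eq_smul_volume_pi hdet
    rw [abs_inv, hR, inv_one, ENNReal.ofReal_one, one_smul] at this
    exact this
  exact (measurePreserving_add_right volume μ).comp
    (hlin.comp (measurePreserving_sub_right volume μ))

/-! ### Fourth moments of elliptical distributions -/

namespace IsElliptical

variable {p : ℕ} {F : Measure (Fin p → ℝ)} {μ : Fin p → ℝ} {M : Matrix (Fin p) (Fin p) ℝ}
  {g : ℝ → ℝ}

/-- The reflection about μ has determinant ±1, so it preserves Lebesgue measure, and it fixes the
quadratic form on which the density depends. -/
theorem measurePreserving_formReflection (hF : IsElliptical F μ M g) {w : Fin p → ℝ}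
    (hw : w ⬝ᵥ (M *ᵥ w) ≠ 0) :
    MeasurePreserving (fun x => formReflection M w *ᵥ (x - μ) + μ) F F := by
  obtain ⟨C, -, hd⟩ := hF.density
  rw [hd]
  refine (measurePreserving_affine_of_abs_det_eq_one (abs_det_formReflection hw)
    μ).withDensity_of_comp_eq ?_ fun x => ?_
  · have hq : Measurable fun x : Fin p → ℝ => (x - μ) ⬝ᵥ (M⁻¹ *ᵥ (x - μ)) := by
      simp only [dotProduct, mulVec]; fun_prop
    exact ((hF.measurable_generator.comp hq).const_mul _).ennreal_ofReal
  · simp only [ellipticalDensity, add_sub_cancel_right,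
      dotProduct_inv_mulVec_formReflection hF.posDef hw]

/-- When `a` and `b` have equal M-norm, the reflection with `w = a - b` turns the functional `a`
into `b`; the claim is then a change of variables. -/
theorem integral_dotProduct_pow_four_congr (hF : IsElliptical F μ M g) {a b : Fin p → ℝ}
    (hab : a ⬝ᵥ (M *ᵥ a) = b ⬝ᵥ (M *ᵥ b)) :
    ∫ x, (a ⬝ᵥ (x - μ)) ^ 4 ∂F = ∫ x, (b ⬝ᵥ (x - μ)) ^ 4 ∂F := by
  rcases eq_or_ne a b with rfl | hne
  · rfl
  have hw : (a - b) ⬝ᵥ (M *ᵥ (a - b)) ≠ 0 := by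
    have := hF.posDef.dotProduct_mulVec_pos (sub_ne_zero.2 hne)
    simpa using this.ne'
  have hsymm : b ⬝ᵥ (M *ᵥ a) = a ⬝ᵥ (M *ᵥ b) := by
    have ht : Mᵀ = M := by simpa using hF.posDef.isHermitian.eq
    rw [dotProduct_mulVec, ← mulVec_transpose, ht, dotProduct_comm]
  have hmp := hF.measurePreserving_formReflection hw
  have hcomp := hmp.hasLaw.integral_comp (f := fun x => (a ⬝ᵥ (x - μ)) ^ 4) (by
    refine Measurable.aestronglyMeasurable ?_
    simp only [dotProduct]; fun_prop)
  rw [← hcomp]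
  refine integral_congr_ae (.of_forall fun x => ?_)
  have hdot : a ⬝ᵥ (formReflection M (a - b) *ᵥ (x - μ)) = b ⬝ᵥ (x - μ) := by
    -- Equality of the M-norms enters here: it makes the coefficient of `(a - b) ⬝ᵥ (x - μ)` exactly
    -- 1.
    have hs : (a - b) ⬝ᵥ (M *ᵥ (a - b)) = 2 * (a ⬝ᵥ (M *ᵥ (a - b))) := by
      simp only [mulVec_sub, dotProduct_sub, sub_dotProduct]
      linarith
    rw [hs] at hw
    have hA : a ⬝ᵥ (M *ᵥ (a - b)) ≠ 0 := fun h => hw (by rw [h, mul_zero])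
    rw [formReflection_mulVec, dotProduct_sub, dotProduct_smul, hs, sub_dotProduct, smul_eq_mul]
    field_simp
    ring
  simp only [Function.comp_apply, add_sub_cancel_right, hdot]

/-- By homogeneity, one fixed vector rescaled to the M-norm of `a` determines the moment. -/
theorem exists_integral_dotProduct_pow_four (hF : IsElliptical F μ M g) :
    ∃ c : ℝ, ∀ a : Fin p → ℝ, ∫ x, (a ⬝ᵥ (x - μ)) ^ 4 ∂F = c * (a ⬝ᵥ (M *ᵥ a)) ^ 2 := by
  rcases isEmpty_or_nonempty (Fin p) with hp | ⟨⟨i⟩⟩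
  · exact ⟨0, fun a => by simp⟩
  set e : Fin p → ℝ := Pi.single i 1 with he
  have hs : 0 < e ⬝ᵥ (M *ᵥ e) := by
    have h0 : e ≠ 0 := fun h => by simpa [he] using congrFun h i
    simpa using hF.posDef.dotProduct_mulVec_pos h0
  refine ⟨(∫ x, (e ⬝ᵥ (x - μ)) ^ 4 ∂F) / (e ⬝ᵥ (M *ᵥ e)) ^ 2, fun a => ?_⟩
  have ha : 0 ≤ a ⬝ᵥ (M *ᵥ a) := by simpa using hF.posDef.posSemidef.dotProduct_mulVec_nonneg a
  set r := Real.sqrt (a ⬝ᵥ (M *ᵥ a) / (e ⬝ᵥ (M *ᵥ e))) with hr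
  have hr2 : r ^ 2 = a ⬝ᵥ (M *ᵥ a) / (e ⬝ᵥ (M *ᵥ e)) := Real.sq_sqrt (by positivity)
  have hq : a ⬝ᵥ (M *ᵥ a) = (r • e) ⬝ᵥ (M *ᵥ (r • e)) := by
    rw [mulVec_smul, dotProduct_smul, smul_dotProduct, smul_eq_mul, smul_eq_mul, ← mul_assoc,
      ← pow_two, hr2, div_mul_cancel₀ _ hs.ne']
  rw [hF.integral_dotProduct_pow_four_congr hq]
  simp only [smul_dotProduct, smul_eq_mul, mul_pow, integral_const_mul]
  rw [show r ^ 4 = (r ^ 2) ^ 2 by ring, hr2]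
  field_simp

theorem memLp_dotProduct (hF : IsElliptical F μ M g)
    (hF4 : ∀ k, MemLp (fun x : Fin p → ℝ => x k) 4 F) (a : Fin p → ℝ) :
    MemLp (fun x => a ⬝ᵥ (x - μ)) 4 F := by
  have := hF.isProbabilityMeasure
  simp only [dotProduct, Pi.sub_apply]
  exact memLp_finsetSum _ fun i _ => ((hF4 i).sub (memLp_const _)).const_mul _

/-- Polarization: (u + v)⁴ + (u - v)⁴ = 2u⁴ + 2v⁴ + 12u²v². -/
theorem integral_sq_mul_sq (hF : IsElliptical F μ M g)
    (hF4 : ∀ k, MemLp (fun x : Fin p → ℝ => x k) 4 F) {c : ℝ}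
    (hc : ∀ a : Fin p → ℝ, ∫ x, (a ⬝ᵥ (x - μ)) ^ 4 ∂F = c * (a ⬝ᵥ (M *ᵥ a)) ^ 2)
    (a b : Fin p → ℝ) :
    ∫ x, (a ⬝ᵥ (x - μ)) ^ 2 * (b ⬝ᵥ (x - μ)) ^ 2 ∂F
      = c / 3 * ((a ⬝ᵥ (M *ᵥ a)) * (b ⬝ᵥ (M *ᵥ b)) + 2 * (a ⬝ᵥ (M *ᵥ b)) ^ 2) := by
  have hL := hF.memLp_dotProduct hF4
  have hsymm : b ⬝ᵥ (M *ᵥ a) = a ⬝ᵥ (M *ᵥ b) := by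
    have ht : Mᵀ = M := by simpa using hF.posDef.isHermitian.eq
    rw [dotProduct_mulVec, ← mulVec_transpose, ht, dotProduct_comm]
  have hpow : ∀ a, Integrable (fun x => (a ⬝ᵥ (x - μ)) ^ 4) F := fun a =>
    ((hL a).integrable_mul_four (hL a) (hL a) (hL a)).congr (.of_forall fun x => by simp only; ring)
  have hmix : Integrable (fun x => (a ⬝ᵥ (x - μ)) ^ 2 * (b ⬝ᵥ (x - μ)) ^ 2) F :=
    ((hL a).integrable_mul_four (hL a) (hL b) (hL b)).congr (.of_forall fun x => by simp only; ring)
  have hpol : (∫ x, ((a + b) ⬝ᵥ (x - μ)) ^ 4 ∂F) + ∫ x, ((a - b) ⬝ᵥ (x - μ)) ^ 4 ∂F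
      = 2 * (∫ x, (a ⬝ᵥ (x - μ)) ^ 4 ∂F) + 2 * (∫ x, (b ⬝ᵥ (x - μ)) ^ 4 ∂F)
        + 12 * ∫ x, (a ⬝ᵥ (x - μ)) ^ 2 * (b ⬝ᵥ (x - μ)) ^ 2 ∂F := by
    have hab : Integrable (fun x => 2 * (a ⬝ᵥ (x - μ)) ^ 4 + 2 * (b ⬝ᵥ (x - μ)) ^ 4) F :=
      ((hpow a).const_mul 2).add ((hpow b).const_mul 2)
    rw [← integral_add (hpow _) (hpow _), ← integral_const_mul, ← integral_const_mul,
      ← integral_const_mul, ← integral_add ((hpow _).const_mul _) ((hpow _).const_mul _),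
      ← integral_add hab (hmix.const_mul _)]
    refine integral_congr_ae (.of_forall fun x => ?_)
    simp only [add_dotProduct, sub_dotProduct]
    ring
  simp only [hc] at hpol
  simp only [mulVec_add, mulVec_sub, dotProduct_add, dotProduct_sub, add_dotProduct,
    sub_dotProduct, hsymm] at hpol ⊢
  linear_combination (-1 / 12) * hpol

/-- In a dual orthonormal family r² is a sum of p squares, so r⁴ is a double sum, and ∑ᵢⱼ (1 + 2δᵢⱼ)
= p(p + 2). -/
theorem integral_generatingVariate_pow_four (hF : IsElliptical F μ M g)
    (hF4 : ∀ k, MemLp (fun x : Fin p → ℝ => x k) 4 F) {c : ℝ}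
    (hc : ∀ a : Fin p → ℝ, ∫ x, (a ⬝ᵥ (x - μ)) ^ 4 ∂F = c * (a ⬝ᵥ (M *ᵥ a)) ^ 2) :
    ∫ x, generatingVariate μ M x ^ 4 ∂F = c / 3 * (p * (p + 2)) := by
  have hL := hF.memLp_dotProduct hF4
  obtain ⟨b, hdot, hQ⟩ := hF.posDef.exists_dual_orthonormal
  have hvar : ∀ x, generatingVariate μ M x ^ 4
      = ∑ i, ∑ j, (b i ⬝ᵥ (x - μ)) ^ 2 * (b j ⬝ᵥ (x - μ)) ^ 2 := by
    intro x
    rw [generatingVariate, show (4 : ℕ) = 2 * 2 from rfl, pow_mul, hQ, Real.sq_sqrt (by positivity),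
      pow_two, Finset.sum_mul_sum]
  have hmix : ∀ a b : Fin p → ℝ,
      Integrable (fun x => (a ⬝ᵥ (x - μ)) ^ 2 * (b ⬝ᵥ (x - μ)) ^ 2) F := fun a b =>
    ((hL a).integrable_mul_four (hL a) (hL b) (hL b)).congr (.of_forall fun x => by simp only; ring)
  simp only [hvar]
  rw [integral_finsetSum _ fun i _ => integrable_finsetSum _ fun j _ => hmix _ _]
  simp only [fun i => integral_finsetSum Finset.univ fun j _ => hmix (b i) (b j),
    hF.integral_sq_mul_sq hF4 hc, hdot]
  simp [← Finset.mul_sum, Finset.sum_add_distrib]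
  ring

/-- The fourth moments of an elliptical distribution in terms of its kurtosis parameter. -/
theorem integral_coord_sq_mul_sq (hF : IsElliptical F μ M g)
    (hF4 : ∀ k, MemLp (fun x : Fin p → ℝ => x k) 4 F) (i j : Fin p) :
    ∫ x, (x i - μ i) ^ 2 * (x j - μ j) ^ 2 ∂F
      = (1 + ellipticalKurtosis F μ M) * (M i i * M j j + 2 * M i j ^ 2) := by
  obtain ⟨c, hc⟩ := hF.exists_integral_dotProduct_pow_four
  have hp : (0 : ℝ) < p := by exact_mod_cast i.pos
  have hκ : c / 3 = 1 + ellipticalKurtosis F μ M := by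
    rw [ellipticalKurtosis, hF.integral_generatingVariate_pow_four hF4 hc]
    field_simp
    ring
  have := hF.integral_sq_mul_sq hF4 hc (Pi.single i 1) (Pi.single j 1)
  simpa [hκ] using this

end IsElliptical

/-! ### The sample covariance as a bilinear form -/

/-- The matrix of the quadratic form whose values are the entries of the sample covariance. -/
noncomputable def sampleCovWeight (n : ℕ) : Matrix (Fin n) (Fin n) ℝ :=
  ((n : ℝ) - 1)⁻¹ • (1 - (n : ℝ)⁻¹ • of fun _ _ => 1)

section SampleCov

variable {n : ℕ}

theorem sampleCovWeight_apply (k l : Fin n) :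
    sampleCovWeight n k l = ((n : ℝ) - 1)⁻¹ * ((if k = l then 1 else 0) - (n : ℝ)⁻¹) := by
  simp [sampleCovWeight, Matrix.one_apply]

theorem sampleCovWeight_diag (hn : 2 ≤ n) (k : Fin n) : sampleCovWeight n k k = (n : ℝ)⁻¹ := by
  have h : (2 : ℝ) ≤ n := by exact_mod_cast hn
  have h0 : (n : ℝ) ≠ 0 := by linarith
  have h1 : (n : ℝ) - 1 ≠ 0 := by linarith
  rw [sampleCovWeight_apply, if_pos rfl]
  field_simp

theorem trace_sampleCovWeight (hn : 2 ≤ n) : (sampleCovWeight n).trace = 1 := by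
  have h0 : (n : ℝ) ≠ 0 := by positivity
  simp [Matrix.trace, sampleCovWeight_diag hn, h0]

theorem transpose_sampleCovWeight : (sampleCovWeight n)ᵀ = sampleCovWeight n := by
  ext k l
  simp only [transpose_apply, sampleCovWeight_apply, eq_comm]

/-- The weight is (n - 1)⁻¹ times the centring projection, which is idempotent. -/
theorem sampleCovWeight_mul_self (hn : 2 ≤ n) :
    sampleCovWeight n * sampleCovWeight n = ((n : ℝ) - 1)⁻¹ • sampleCovWeight n := by
  have h0 : (n : ℝ) ≠ 0 := by positivity
  have hJ : (of fun _ _ => (1 : ℝ) : Matrix (Fin n) (Fin n) ℝ) * (of fun _ _ => 1)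
      = (n : ℝ) • of fun _ _ => 1 := by
    ext k l; simp [Matrix.mul_apply]
  have hc : (n : ℝ)⁻¹ * (n : ℝ)⁻¹ * n = (n : ℝ)⁻¹ := by field_simp
  simp only [sampleCovWeight, smul_mul_smul_comm, sub_mul, mul_sub, one_mul, mul_one, hJ,
    smul_smul, hc]
  simp

/-- The shifts `a`, `b` drop out because rows and columns of the weight sum to zero; they can thus
be chosen as the true means. -/
theorem sum_sampleCovWeight_mul (hn : 2 ≤ n) (u v : Fin n → ℝ) (a b : ℝ) :
    ∑ k, ∑ l, sampleCovWeight n k l * ((u k - a) * (v l - b))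
      = ((n : ℝ) - 1)⁻¹ * ∑ k, (u k - (n : ℝ)⁻¹ * ∑ l, u l) * (v k - (n : ℝ)⁻¹ * ∑ l, v l) := by
  have h0 : (n : ℝ) ≠ 0 := by positivity
  simp only [sampleCovWeight_apply, mul_assoc, ← Finset.mul_sum, sub_mul, ite_mul, zero_mul,
    one_mul, Finset.sum_sub_distrib, Finset.sum_ite_eq, Finset.mem_univ, if_true]
  congr 1
  simp only [mul_sub, Finset.sum_sub_distrib, ← Finset.mul_sum, ← Finset.sum_mul,
    Finset.sum_const, Finset.card_univ, Fintype.card_fin, nsmul_eq_mul]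
  field_simp
  ring

theorem sampleCov_apply {p : ℕ} (hn : 2 ≤ n) (x : Fin n → Fin p → ℝ) (μ : Fin p → ℝ)
    (i j : Fin p) :
    sampleCov x i j
      = ∑ k, ∑ l, sampleCovWeight n k l * ((x k i - μ i) * (x l j - μ j)) := by
  rw [sum_sampleCovWeight_mul hn (fun k => x k i) (fun k => x k j)]
  simp [sampleCov, sampleMean, Matrix.sum_apply, vecMulVec_apply]

end SampleCov

/-- Mixed second moments of the entries of the sample covariance of an i.i.d. sample. -/
theorem integral_sampleCov_mul_sampleCov {Ω : Type*} [MeasurableSpace Ω] {P : Measure Ω}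
    {n p : ℕ} (hn : 2 ≤ n) {μ : Fin p → ℝ} {M : Matrix (Fin p) (Fin p) ℝ}
    {F : Measure (Fin p → ℝ)} [IsProbabilityMeasure F]
    (hF4 : ∀ k, MemLp (fun x : Fin p → ℝ => x k) 4 F)
    (hmean : ∀ i, ∫ x, x i ∂F = μ i)
    (hcov : ∀ i j, ∫ x, (x i - μ i) * (x j - μ j) ∂F = M i j)
    {X : Fin n → Ω → Fin p → ℝ} (hlaw : ∀ i, HasLaw (X i) F P) (hindep : iIndepFun X P)
    (i j i' j' : Fin p) :
    Integrable (fun ω => sampleCov (fun k => X k ω) i j * sampleCov (fun k => X k ω) i' j') P ∧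
    ∫ ω, sampleCov (fun k => X k ω) i j * sampleCov (fun k => X k ω) i' j' ∂P
      = M i j * M i' j' + ((n : ℝ) - 1)⁻¹ * (M i i' * M j j' + M i j' * M j i')
        + (n : ℝ)⁻¹ * (∫ x, (x i - μ i) * (x j - μ j) * (x i' - μ i') * (x j' - μ j') ∂F
          - M i j * M i' j' - M i i' * M j j' - M i j' * M j i') := by
  have hm : ∀ i, Measurable fun x : Fin p → ℝ => x i - μ i := fun i => by fun_prop
  have h4 : ∀ i, MemLp (fun x : Fin p → ℝ => x i - μ i) 4 F := fun i =>
    (hF4 i).sub (memLp_const _)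
  have h0 : ∀ i, ∫ x, (x i - μ i) ∂F = 0 := fun i => by
    rw [integral_sub ((hF4 i).integrable (by norm_num)) (integrable_const _), hmean]
    simp
  have key := integral_bilinear_mul_bilinear_of_iid hlaw hindep (sampleCovWeight n)
    (hm i) (hm j) (hm i') (hm j') (h4 i) (h4 j) (h4 i') (h4 j') (h0 i) (h0 j) (h0 i') (h0 j')
  have hn0 : (n : ℝ) ≠ 0 := by positivity
  simp only [sampleCov_apply hn _ μ]
  refine ⟨key.1, key.2.trans ?_⟩
  simp only [hcov, transpose_sampleCovWeight, sampleCovWeight_mul_self hn, trace_smul,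
    trace_sampleCovWeight hn, sampleCovWeight_diag hn, Finset.sum_const, Finset.card_univ,
    Fintype.card_fin, nsmul_eq_mul, smul_eq_mul]
  field_simp
  ring

theorem lemma2 {Ω : Type*} [MeasurableSpace Ω] (P : Measure Ω) [IsProbabilityMeasure P]
    {n p : ℕ} (hn : 2 ≤ n) (hp : 1 ≤ p)
    (μ : Fin p → ℝ) (M : Matrix (Fin p) (Fin p) ℝ) (g : ℝ → ℝ)
    (F : Measure (Fin p → ℝ)) (hF : IsElliptical F μ M g)
    (hF4 : ∀ k, MemLp (fun x : Fin p → ℝ => x k) 4 F)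
    (X : Fin n → Ω → Fin p → ℝ)
    (hlaw : ∀ i, HasLaw (X i) F P) (hindep : iIndepFun X P)
    (S : Ω → Matrix (Fin p) (Fin p) ℝ) (hS : ∀ ω, S ω = sampleCov (fun i => X i ω))
    (κ : ℝ) (hκ : κ = ellipticalKurtosis F μ M) :
    (Integrable (fun ω => (S ω ^ 2).trace) P ∧
      ∫ ω, (S ω ^ 2).trace ∂P
        = (1 / ((n : ℝ) - 1) + κ / n) * M.trace ^ 2
          + (1 + 1 / ((n : ℝ) - 1) + 2 * κ / n) * (M ^ 2).trace) ∧
    (Integrable (fun ω => (S ω).trace ^ 2) P ∧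
      ∫ ω, (S ω).trace ^ 2 ∂P
        = (1 + κ / n) * M.trace ^ 2
          + 2 * (1 / ((n : ℝ) - 1) + κ / n) * (M ^ 2).trace) := by
  have := hF.isProbabilityMeasure
  obtain rfl : S = fun ω => sampleCov (fun i => X i ω) := funext hS
  have hsymm : ∀ i j, M j i = M i j := fun i j => by simpa using hF.posDef.isHermitian.apply i j
  have hmom := fun i j i' j' => integral_sampleCov_mul_sampleCov hn hF4 hF.mean hF.covariance
    hlaw hindep i j i' j'
  have hsq : ∀ i j, ∫ x, (x i - μ i) ^ 2 * (x j - μ j) ^ 2 ∂F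
      = (1 + κ) * (M i i * M j j + 2 * M i j ^ 2) := fun i j => by
    rw [hκ, hF.integral_coord_sq_mul_sq hF4]
  have htr : M.trace ^ 2 = ∑ i, ∑ j, M i i * M j j := by
    rw [pow_two, Matrix.trace, Finset.sum_mul_sum]; rfl
  have htr2 : (M ^ 2).trace = ∑ i, ∑ j, M i j ^ 2 := by
    simp only [pow_two, Matrix.trace, diag_apply, Matrix.mul_apply]
    exact Finset.sum_congr rfl fun i _ => Finset.sum_congr rfl fun j _ => by rw [hsymm]
  constructor
  · have hexp : (fun ω => (sampleCov (fun i => X i ω) ^ 2).trace) = fun ω => ∑ i, ∑ j,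
        sampleCov (fun k => X k ω) i j * sampleCov (fun k => X k ω) j i := by
      ext ω; simp only [pow_two, Matrix.trace, diag_apply, Matrix.mul_apply]
    rw [hexp]
    refine ⟨integrable_finsetSum _ fun i _ => integrable_finsetSum _ fun j _ =>
      (hmom i j j i).1, ?_⟩
    rw [integral_finsetSum _ fun i _ => integrable_finsetSum _ fun j _ => (hmom i j j i).1,
      htr, htr2]
    simp only [Finset.mul_sum, ← Finset.sum_add_distrib]
    refine Finset.sum_congr rfl fun i _ => ?_
    rw [integral_finsetSum _ fun j _ => (hmom i j j i).1]
    refine Finset.sum_congr rfl fun j _ => ?_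
    have h4 : ∫ x, (x i - μ i) * (x j - μ j) * (x j - μ j) * (x i - μ i) ∂F
        = (1 + κ) * (M i i * M j j + 2 * M i j ^ 2) := by
      rw [← hsq]; congr 1; ext x; ring
    -- One cross pairing gives `M i i * M j j`, the other `M i j ^ 2`, each with weight 1/(n - 1).
    rw [(hmom i j j i).2, h4, hsymm i j]
    ring
  · have hexp : (fun ω => (sampleCov (fun i => X i ω)).trace ^ 2) = fun ω => ∑ i, ∑ j,
        sampleCov (fun k => X k ω) i i * sampleCov (fun k => X k ω) j j := by
      ext ω; rw [pow_two, Matrix.trace, Finset.sum_mul_sum]; rfl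
    rw [hexp]
    refine ⟨integrable_finsetSum _ fun i _ => integrable_finsetSum _ fun j _ =>
      (hmom i i j j).1, ?_⟩
    rw [integral_finsetSum _ fun i _ => integrable_finsetSum _ fun j _ => (hmom i i j j).1,
      htr, htr2]
    simp only [Finset.mul_sum, ← Finset.sum_add_distrib]
    refine Finset.sum_congr rfl fun i _ => ?_
    rw [integral_finsetSum _ fun j _ => (hmom i i j j).1]
    refine Finset.sum_congr rfl fun j _ => ?_
    have h4 : ∫ x, (x i - μ i) * (x i - μ i) * (x j - μ j) * (x j - μ j) ∂F
        = (1 + κ) * (M i i * M j j + 2 * M i j ^ 2) := by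
      rw [← hsq]; congr 1; ext x; ring
    -- Here both cross pairings give `M i j ^ 2`, whence the factor 2 on 1/(n - 1).
    rw [(hmom i i j j).2, h4]
    ring
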